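/- Let $d$ be a square-free positive integer, let $E=\mathbb{Q}(\sqrt{-d})$, let $\mathcal{O}$ be its ring of integers, and let $\overline{\alpha}$ denote the complex conjugate of $\alpha$. A Hermitian space $(V,h)$ over $E$ is an $E$-vector space $V$ with a map $h:V\times V\to E$ that is $E$-linear in the first variable and satisfies $h(v,w)=\overline{h(w,v)}$. For finitely generated $\mathcal{O}$-submodules (lattices) $L$ and $K$ of Hermitian spaces, $L\to K$ ("$L$ is represented by $K$") means that there is an injective $\mathcal{O}$-linear map $\sigma:L\to K$ with $h_L(v,w)=h_K(\sigma(v),\sigma(w))$ for all $v,w\in L$. Let $I_4$ be the free Hermitian $\mathcal{O}$-lattice of rank $4$ with an orthonormal basis. Let $\mathfrak{P}$ be a non-principal prime ideal of $\mathcal{O}$, let $p$ be the prime number lying below $\mathfrak{P}$, and suppose that $p$ is odd and $p\nmid d$. For a positive integer $r$, let $\mathfrak{P}v^r$ denote the unary Hermitian lattice $\{\alpha v^r:\alpha\in\mathfrak{P}\}$, where $v^r$ is a vector of a Hermitian space over $E$ with $h(v^r,v^r)=r/p$. (a) If $d\equiv 1,2\pmod 4$, then there is a least positive integer $n$ with $-d\equiv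 n^2\pmod p$, and with this $n$ one has $\mathfrak{P}v^r\to I_4$ for every positive integer $$r\ \ge\ C:=\frac{p(p-1)^2}{4}+(p-1)n+\frac{d+n^2}{p}+2pd.$$ (b) If $d\equiv 3\pmod 4$, then there is a least positive odd integer $n$ with $-d\equiv n^2\pmod p$, and with this $n$ one has $\mathfrak{P}v^r\to I_4$ for every positive integer $$r\ \ge\ C:=\frac{p(p-1)^2}{4}+(p-1)n+\frac{d+n^2}{p}+\frac{p(d+1)}{4}.$$ -/

import Mathlib

open scoped NumberField ComplexConjugate

/-- The imaginary quadratic field `ℚ(√-d)`: elements are `⟨x, y⟩ = x + y √-d` with `x y : ℚ`, and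
`star` is complex conjugation `x + y √-d ↦ x - y √-d`. -/
abbrev ImQuadField (d : ℕ) : Type := QuadraticAlgebra ℚ (-(d : ℚ)) 0

/-- For `d > 0` the number `-d` is not a rational square; this makes `ImQuadField d` a field. -/
instance ImQuadField.fact_not_square (d : ℕ) [NeZero d] :
    Fact (∀ r : ℚ, r ^ 2 ≠ -(d : ℚ) + 0 * r) where
  out r h := by
    have hd : (0 : ℚ) < d := by exact_mod_cast Nat.pos_of_neZero d
    nlinarith [sq_nonneg r]

/-- A Hermitian map `h : V × V → E` on an `E`-vector space `V`, where `star` is the conjugation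
of `E`: it is linear in the first variable, conjugate-linear in the second one, and
`h v w` is the conjugate of `h w v`. -/
structure HermitianMap (E V : Type*) [Field E] [StarRing E] [AddCommGroup V] [Module E V] where
  /-- The underlying sesquilinear map. -/
  form : V →ₗ[E] V →ₗ⋆[E] E
  conj_symm : ∀ v w : V, form v w = conj (form w v)

section Lattices

variable {E V W : Type*} [Field E] [StarRing E]
  [AddCommGroup V] [Module E V] [Module (𝓞 E) V]
  [AddCommGroup W] [Module E W] [Module (𝓞 E) W]

/-- The lattice `L` in the Hermitian space `(V, h)` is represented by the lattice `K` in the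
Hermitian space `(W, k)`: there is an injective `𝓞 E`-linear map `L → K` that preserves the
Hermitian maps. -/
def IsRepresentedBy (h : HermitianMap E V) (L : Submodule (𝓞 E) V)
    (k : HermitianMap E W) (K : Submodule (𝓞 E) W) : Prop :=
  ∃ σ : L →ₗ[𝓞 E] K, Function.Injective σ ∧
    ∀ v w : L, h.form (v : V) (w : V) = k.form (σ v : W) (σ w : W)

/-- The unary lattice `𝔄 v = {α v : α ∈ 𝔄}` attached to an ideal `𝔄` and a vector `v`. -/
def unaryLattice (𝔄 : Ideal (𝓞 E)) (v : V) : Submodule (𝓞 E) V :=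
  Submodule.map (LinearMap.toSpanSingleton (𝓞 E) V v) 𝔄

end Lattices

/-- The standard Hermitian map `(x, y) ↦ ∑ x_i conj(y_i)` on `E ^ m`. -/
def stdHermitianMap (E : Type*) [Field E] [StarRing E] (m : ℕ) : HermitianMap E (Fin m → E) where
  form := LinearMap.mk₂'ₛₗ (RingHom.id E) (starRingEnd E)
    (fun x y => ∑ i, x i * conj (y i))
    (fun x x' y => by simp [add_mul, Finset.sum_add_distrib])
    (fun c x y => by simp [Finset.mul_sum, mul_assoc])
    (fun x y y' => by simp [mul_add, Finset.sum_add_distrib])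
    (fun c x y => by simp [Finset.mul_sum, mul_left_comm])
  conj_symm x y := by simp [map_sum, mul_comm]

/-- The lattice `I_m`: the free `𝓞 E`-lattice in `E ^ m` on the standard orthonormal basis. -/
def stdLattice (E : Type*) [Field E] (m : ℕ) : Submodule (𝓞 E) (Fin m → E) :=
  Submodule.span (𝓞 E) (Set.range fun i : Fin m => (Pi.single i 1 : Fin m → E))

/-! A representation of `𝔓 v` by `I_4` amounts to a vector `w ∈ E⁴` with `𝔓 wᵢ ⊆ 𝓞` and `∑ N(wᵢ) =
r/p`, through `αv ↦ αw`. Only `w₀` needs a denominator.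

Since `𝔓` is not principal, it is not `p𝓞`, so it contains some `a + b√-d` with `p ∤ b`. Its norm is
divisible by `p`, hence `a ≡ ±nb`, and for one sign `t = ±n` one gets `𝔓 (t - √-d) ⊆ p𝓞`
(`exists_mul_isIntegral`). If `d ≡ 3 (mod 4)` and `n` is odd, `2p` may replace `p`.

Take `w₀ = x + (t - √-d)/p`, or the same with `2p`. A congruence on `x` modulo `p` makes `m = r/p -
N(w₀)` an integer, and it can be solved with `|x| ≤ (p-1)/2`. The bound `C` then makes `m` at least
`2d`, respectively `(d+1)/4`. It remains to write `m` as a sum of three norms of integers, which the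
three squares theorem for `N ≡ 1, 2 (mod 4)` provides after subtracting a few copies of `d`,
respectively one `(d+1)/4`.

The three squares theorem is proved classically: a positive ternary form of determinant one reduces
to `u² + v² + w²`, and Dirichlet's theorem with quadratic reciprocity yields such a form with value
`N`. -/

/-! ### Reduction of binary and ternary quadratic forms -/

theorem Int.exists_four_mul_add_mul_sq_le (f : ℤ) {a : ℤ} (ha : 0 < a) :
    ∃ k : ℤ, 4 * (f + a * k) ^ 2 ≤ a ^ 2 := by
  refine ⟨-((2 * f + a) / (2 * a)), ?_⟩
  have h1 := Int.emod_add_mul_ediv (2 * f + a) (2 * a)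
  have h2 := Int.emod_nonneg (2 * f + a) (show 2 * a ≠ 0 by lia)
  have h3 := Int.emod_lt_of_pos (2 * f + a) (show 0 < 2 * a by lia)
  set k := (2 * f + a) / (2 * a)
  have h4 : -a ≤ 2 * (f + a * -k) := by linarith
  have h5 : 2 * (f + a * -k) ≤ a := by linarith
  nlinarith

/-- Reduction of a positive definite binary quadratic form `A x² + 2 B x y + C y²`: it properly
represents some `m > 0` with `3 m² ≤ 4 (A C - B²)`. -/
theorem exists_reduced_binary_form (A B C : ℤ) (hA : 0 < A) (hD : 0 < A * C - B ^ 2) :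
    ∃ p q r s : ℤ, p * s - q * r = 1 ∧ 0 < A * p ^ 2 + 2 * B * p * r + C * r ^ 2 ∧
      3 * (A * p ^ 2 + 2 * B * p * r + C * r ^ 2) ^ 2 ≤ 4 * (A * C - B ^ 2) := by
  induction hn : A.toNat using Nat.strong_induction_on generalizing A B C with
  | _ n ih =>
    obtain ⟨k, hk⟩ := B.exists_four_mul_add_mul_sq_le hA
    set B' := B + A * k with hB'
    obtain ⟨C', hC'⟩ : ∃ C' : ℤ, C' = A * k ^ 2 + 2 * B * k + C := ⟨_, rfl⟩
    have hD' : A * C' - B' ^ 2 = A * C - B ^ 2 := by rw [hC', hB']; ring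
    have hC0 : 0 < C' := by
      by_contra! hc
      nlinarith [sq_nonneg B']
    by_cases hlt : C' < A
    · obtain ⟨p, q, r, s, h1, h2, h3⟩ :=
        ih C'.toNat (by lia) C' (-B') A hC0 (by linarith) rfl
      have key : A * (-r + k * p) ^ 2 + 2 * B * (-r + k * p) * p + C * p ^ 2 =
          C' * p ^ 2 + 2 * -B' * p * r + A * r ^ 2 := by rw [hC', hB']; ring
      refine ⟨-r + k * p, -s + k * q, p, q, by linarith, by rwa [key], ?_⟩
      rw [key]
      linarith
    -- The translation by `k` keeps the leading coefficient `A`, so the identity matrix serves. From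
    -- `A ≤ C'` and `4B'² ≤ A²` one gets `3A² ≤ 4(AC' - B'²)`.
    · refine ⟨1, 0, 0, 1, by norm_num, by simpa using hA, ?_⟩
      have : A ^ 2 ≤ A * C' := by nlinarith
      linarith

/-- The end of the ternary descent: `3a² ≤ 4(ab - f²)` combined with the hypothesis gives `27a³ ≤
64`. -/
theorem leading_coeff_eq_one_of_reduced {a b f : ℤ} (ha : 0 < a) (hab : a ≤ b)
    (hf : 4 * f ^ 2 ≤ a ^ 2) (h : 3 * (a * b - f ^ 2) ^ 2 ≤ 4 * a) : a = 1 := by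
  have h4 : 3 * a ^ 2 ≤ 4 * (a * b - f ^ 2) := by
    have : a * a ≤ a * b := mul_le_mul_of_nonneg_left hab ha.le
    linarith
  have h5 : (3 * a ^ 2) ^ 2 ≤ (4 * (a * b - f ^ 2)) ^ 2 :=
    pow_le_pow_left₀ (by positivity) h4 2
  have h6 : a * (27 * a ^ 3) ≤ a * 64 := by linarith
  have h7 : 27 * a ^ 3 ≤ 64 := le_of_mul_le_mul_left h6 ha
  by_contra hne
  have : 2 ≤ a := by lia
  have : (2 : ℤ) ^ 3 ≤ a ^ 3 := pow_le_pow_left₀ (by norm_num) this 3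
  lia

theorem Int.eq_one_of_three_mul_sq_le {t : ℤ} (ht : 0 < t) (h : 3 * t ^ 2 ≤ 4) : t = 1 := by
  have : t < 2 := by
    by_contra! h
    nlinarith
  lia

/-- Every value of a positive definite ternary quadratic form with integral matrix of determinant
one is a sum of three squares. -/
theorem ternary_form_eq_sum_three_squares (a b c d e f : ℤ) (ha : 0 < a) (hab : 0 < a * b - f ^ 2)
    (hdet : a * b * c + 2 * d * e * f - a * d ^ 2 - b * e ^ 2 - c * f ^ 2 = 1) (x y z : ℤ) :
    ∃ u v w : ℤ, a * x ^ 2 + b * y ^ 2 + c * z ^ 2 + 2 * d * y * z + 2 * e * x * z +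
      2 * f * x * y = u ^ 2 + v ^ 2 + w ^ 2 := by
  induction hn : a.toNat using Nat.strong_induction_on generalizing a b c d e f x y z with
  | _ n ih =>
    -- For the ternary form `Q`, `aQ - (ax + fy + ez)²` is a binary form in `y, z` of determinant
    -- `a`. Reducing it by a unimodular change of `y, z` gives `3(ab₁ - f₁²)² ≤ 4a`.
    have hD : (a * b - f ^ 2) * (a * c - e ^ 2) - (a * d - e * f) ^ 2 = a := by
      linear_combination a * hdet
    obtain ⟨p, q, r, s, h1, h2, h3⟩ := exists_reduced_binary_form (a * b - f ^ 2) (a * d - e * f)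
      (a * c - e ^ 2) hab (by rwa [hD])
    rw [hD] at h3
    obtain ⟨f₁, hf₁⟩ : ∃ t : ℤ, t = f * p + e * r := ⟨_, rfl⟩
    obtain ⟨e₁, he₁⟩ : ∃ t : ℤ, t = f * q + e * s := ⟨_, rfl⟩
    obtain ⟨b₁, hb₁⟩ : ∃ t : ℤ, t = b * p ^ 2 + 2 * d * p * r + c * r ^ 2 := ⟨_, rfl⟩
    obtain ⟨c₁, hc₁⟩ : ∃ t : ℤ, t = b * q ^ 2 + 2 * d * q * s + c * s ^ 2 := ⟨_, rfl⟩
    obtain ⟨d₁, hd₁⟩ : ∃ t : ℤ, t = b * p * q + d * (p * s + q * r) + c * r * s := ⟨_, rfl⟩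
    have hA : (a * b - f ^ 2) * p ^ 2 + 2 * (a * d - e * f) * p * r + (a * c - e ^ 2) * r ^ 2 =
        a * b₁ - f₁ ^ 2 := by rw [hb₁, hf₁]; ring
    rw [hA] at h2 h3
    have hdet₁ : a * b₁ * c₁ + 2 * d₁ * e₁ * f₁ - a * d₁ ^ 2 - b₁ * e₁ ^ 2 - c₁ * f₁ ^ 2 = 1 := by
      have : a * b₁ * c₁ + 2 * d₁ * e₁ * f₁ - a * d₁ ^ 2 - b₁ * e₁ ^ 2 - c₁ * f₁ ^ 2 =
          (p * s - q * r) ^ 2 *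
            (a * b * c + 2 * d * e * f - a * d ^ 2 - b * e ^ 2 - c * f ^ 2) := by
        rw [hf₁, he₁, hb₁, hc₁, hd₁]; ring
      rw [this, h1, hdet]; norm_num
    have hval₁ : a * x ^ 2 + b * y ^ 2 + c * z ^ 2 + 2 * d * y * z + 2 * e * x * z +
        2 * f * x * y = a * x ^ 2 + b₁ * (s * y - q * z) ^ 2 + c₁ * (p * z - r * y) ^ 2 +
          2 * d₁ * (s * y - q * z) * (p * z - r * y) + 2 * e₁ * x * (p * z - r * y) +
          2 * f₁ * x * (s * y - q * z) := by
      have hy : y = p * (s * y - q * z) + q * (p * z - r * y) := by linear_combination (-y) * h1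
      have hz : z = r * (s * y - q * z) + s * (p * z - r * y) := by linear_combination (-z) * h1
      generalize s * y - q * z = Y at *
      generalize p * z - r * y = Z at *
      rw [hf₁, he₁, hb₁, hc₁, hd₁, hy, hz]; ring
    rw [hval₁]
    generalize s * y - q * z = Y
    generalize p * z - r * y = Z
    -- Translating `x` by a multiple of `Y` makes `|2f₂| ≤ a` and preserves the minor `ab₁ - f₁²`.
    obtain ⟨k, hk⟩ := f₁.exists_four_mul_add_mul_sq_le ha
    obtain ⟨f₂, hf₂⟩ : ∃ t : ℤ, t = f₁ + a * k := ⟨_, rfl⟩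
    obtain ⟨b₂, hb₂⟩ : ∃ t : ℤ, t = a * k ^ 2 + 2 * f₁ * k + b₁ := ⟨_, rfl⟩
    obtain ⟨d₂, hd₂⟩ : ∃ t : ℤ, t = d₁ + k * e₁ := ⟨_, rfl⟩
    have hA₂ : a * b₂ - f₂ ^ 2 = a * b₁ - f₁ ^ 2 := by rw [hb₂, hf₂]; ring
    rw [← hA₂] at h2 h3
    rw [← hf₂] at hk
    have hdet₂ : a * b₂ * c₁ + 2 * d₂ * e₁ * f₂ - a * d₂ ^ 2 - b₂ * e₁ ^ 2 - c₁ * f₂ ^ 2 = 1 := by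
      rw [← hdet₁, hf₂, hb₂, hd₂]; ring
    have hval₂ : a * x ^ 2 + b₁ * Y ^ 2 + c₁ * Z ^ 2 + 2 * d₁ * Y * Z + 2 * e₁ * x * Z +
        2 * f₁ * x * Y = a * (x - k * Y) ^ 2 + b₂ * Y ^ 2 + c₁ * Z ^ 2 + 2 * d₂ * Y * Z +
          2 * e₁ * (x - k * Y) * Z + 2 * f₂ * (x - k * Y) * Y := by
      rw [hf₂, hb₂, hd₂]; ring
    rw [hval₂]
    generalize x - k * Y = X
    have hb0 : 0 < b₂ := by
      have : 0 < a * b₂ := by linarith [sq_nonneg f₂]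
      exact pos_of_mul_pos_right this ha.le
    -- If `b₂ < a`, exchanging the first two variables lowers the leading coefficient; otherwise the
    -- form is reduced and `a = 1`.
    by_cases hlt : b₂ < a
    · obtain ⟨u, v, w, h⟩ := ih b₂.toNat (by lia) b₂ a c₁ e₁ d₂ f₂ hb0 (by linarith)
        (by linarith) Y X Z rfl
      exact ⟨u, v, w, by linarith⟩
    · have ha1 := leading_coeff_eq_one_of_reduced ha (not_lt.1 hlt) hk h3
      subst ha1
      have hf0 : f₂ = 0 := by
        have h4 : f₂ ^ 2 < 1 := by lia
        have h5 : f₂ ^ 2 = 0 := le_antisymm (by lia) (sq_nonneg f₂)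
        exact pow_eq_zero_iff two_ne_zero |>.1 h5
      subst hf0
      have hb1 : b₂ = 1 := Int.eq_one_of_three_mul_sq_le hb0 (by simpa using h3)
      subst hb1
      -- Determinant one now reads `c₁ = 1 + d₂² + e₁²`, so completing squares leaves exactly `Z²`.
      exact ⟨X + e₁ * Z, Y + d₂ * Z, Z, by linear_combination Z ^ 2 * hdet₂⟩

/-- If `-b` is a square modulo `b N - 1`, then `N` is a sum of three squares. -/
theorem sum_three_squares_of_dvd {N b t : ℤ} (hb : 0 < b) (hm : 0 < b * N - 1)
    (ht : b * N - 1 ∣ t ^ 2 + b) : ∃ u v w : ℤ, N = u ^ 2 + v ^ 2 + w ^ 2 := by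
  obtain ⟨a, ha⟩ := ht
  have ha0 : 0 < a := by
    have : 0 < (b * N - 1) * a := by rw [← ha]; positivity
    exact pos_of_mul_pos_right this hm.le
  -- The matrix with rows `(a, t, 1)`, `(t, bN-1, 0)`, `(1, 0, N)` has leading minor `a(bN-1) - t² =
  -- b` and determinant `1`; its form takes the value `N` at `(0, 0, 1)`.
  obtain ⟨u, v, w, h⟩ := ternary_form_eq_sum_three_squares a (b * N - 1) N 0 1 t ha0
    (by linarith) (by linear_combination (-N) * ha) 0 0 1
  exact ⟨u, v, w, by linarith⟩

/-! ### Three squares, and sums of three norms -/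

open NumberTheorySymbols in
theorem exists_dvd_sq_add_of_jacobiSym_neg {q : ℕ} (hq : q.Prime) {b : ℤ} (h : J(-b | q) = 1) :
    ∃ t : ℤ, (q : ℤ) ∣ t ^ 2 + b := by
  have := Fact.mk hq
  obtain ⟨y, hy⟩ := ZMod.isSquare_of_jacobiSym_eq_one h
  obtain ⟨t, rfl⟩ := ZMod.intCast_surjective y
  refine ⟨t, (ZMod.intCast_zmod_eq_zero_iff_dvd _ _).1 ?_⟩
  push_cast at hy ⊢
  linear_combination -hy

-- Dirichlet gives a prime `q = bN - 1` with `b = 4v + 1`. As `q ≡ 1 (mod 4)` and `q ≡ -1 (mod b)`,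
-- reciprocity gives `(-b|q) = (q|b) = (-1|b) = 1`.
open NumberTheorySymbols in
theorem sum_three_squares_of_mod_four_eq_two {N : ℕ} (hN : N % 4 = 2) :
    ∃ u v w : ℤ, (N : ℤ) = u ^ 2 + v ^ 2 + w ^ 2 := by
  have hcop : (N - 1).Coprime (4 * N) := by
    have h1 : (N - 1).Coprime N := by
      rw [Nat.coprime_self_sub_left (by lia)]; exact Nat.coprime_one_left N
    have h2 : (N - 1).Coprime 4 := by
      rw [Nat.coprime_comm]
      exact Nat.Coprime.pow_left 2 (Nat.coprime_two_left.2 (Nat.odd_iff.2 (by lia)))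
    exact h2.mul_right h1
  obtain ⟨q, hgt, hq, hmod⟩ :=
    Nat.forall_exists_prime_gt_and_modEq (N - 1) (show 4 * N ≠ 0 by lia) hcop
  obtain ⟨v, hv⟩ := (Nat.modEq_iff_dvd' hgt.le).1 hmod.symm
  have hqv : q + 1 = (4 * v + 1) * N := by
    have : q = 4 * N * v + (N - 1) := by lia
    rw [this]; zify [show 1 ≤ N by lia]; ring
  have hq4 : q % 4 = 1 := by
    have : q = 4 * (N * v) + (N - 1) := by rw [← mul_assoc]; lia
    lia
  have hqZ : (q : ℤ) = (4 * v + 1 : ℕ) * N - 1 := by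
    have : (q : ℤ) + 1 = (4 * v + 1 : ℕ) * N := by exact_mod_cast hqv
    linarith
  have hb : Odd (4 * v + 1) := ⟨2 * v, by ring⟩
  have hJ : J(-((4 * v + 1 : ℕ) : ℤ) | q) = 1 := by
    rw [jacobiSym.neg _ (Nat.odd_iff.2 (by lia)), ZMod.χ₄_nat_one_mod_four hq4, one_mul,
      jacobiSym.quadratic_reciprocity_one_mod_four (by lia) (Nat.odd_iff.2 (by lia)),
      jacobiSym.mod_left' (a₂ := -1) (by
        rw [hqZ]; exact Int.ModEq.symm (Int.modEq_iff_dvd.2 ⟨N, by ring⟩)), jacobiSym.at_neg_one hb, ZMod.χ₄_nat_one_mod_four (by lia)]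
  obtain ⟨t, ht⟩ := exists_dvd_sq_add_of_jacobiSym_neg hq hJ
  rw [hqZ] at ht
  exact sum_three_squares_of_dvd (by positivity) (by rw [← hqZ]; exact_mod_cast hq.pos) ht

-- Here `bN - 1` is even, so one takes `bN - 1 = 2q` with `q` prime and `b = 8v + 3`. Then `(-b|q) =
-- (q|b)` in both classes of `q` modulo 4, and `(2|b)(q|b) = (-1|b) = -1` with `(2|b) = -1` gives
-- `(q|b) = 1`.
open NumberTheorySymbols in
theorem sum_three_squares_of_mod_four_eq_one {N : ℕ} (hN : N % 4 = 1) :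
    ∃ u v w : ℤ, (N : ℤ) = u ^ 2 + v ^ 2 + w ^ 2 := by
  obtain ⟨g, hg⟩ : ∃ g, 2 * g + 1 = 3 * N := ⟨(3 * N - 1) / 2, by lia⟩
  have hcop : g.Coprime (4 * N) := by
    have h1 : g.Coprime N := by
      have : IsCoprime (g : ℤ) N := ⟨-2, 3, by
        have : (2 * g + 1 : ℤ) = 3 * N := by exact_mod_cast hg
        linarith⟩
      exact Nat.isCoprime_iff_coprime.1 this
    have h2 : g.Coprime 4 := by
      rw [Nat.coprime_comm]
      exact Nat.Coprime.pow_left 2 (Nat.coprime_two_left.2 (Nat.odd_iff.2 (by lia)))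
    exact h2.mul_right h1
  obtain ⟨q, hgt, hq, hmod⟩ :=
    Nat.forall_exists_prime_gt_and_modEq g (show 4 * N ≠ 0 by lia) hcop
  obtain ⟨v, hv⟩ := (Nat.modEq_iff_dvd' hgt.le).1 hmod.symm
  have hq' : q = 4 * (N * v) + g := by rw [← mul_assoc]; lia
  have hqv : 2 * q + 1 = (8 * v + 3) * N := by
    rw [hq']; linear_combination hg
  have hqodd : Odd q := Nat.odd_iff.2 (by lia)
  have hqZ : 2 * (q : ℤ) = (8 * v + 3 : ℕ) * N - 1 := by
    have : 2 * (q : ℤ) + 1 = (8 * v + 3 : ℕ) * N := by exact_mod_cast hqv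
    linarith
  have hb : Odd (8 * v + 3) := ⟨4 * v + 1, by ring⟩
  have hqb : J(q | 8 * v + 3) = 1 := by
    have h1 : J(2 * q | 8 * v + 3) = -1 := by
      rw [jacobiSym.mod_left' (a₂ := -1) (by
        rw [hqZ]; exact Int.ModEq.symm (Int.modEq_iff_dvd.2 ⟨N, by ring⟩)),
        jacobiSym.at_neg_one hb, ZMod.χ₄_nat_three_mod_four (by lia)]
    have h2 : J(2 | 8 * v + 3) = -1 := by
      rw [jacobiSym.at_two hb, ZMod.χ₈_nat_mod_eight, show (8 * v + 3) % 8 = 3 by lia]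
      decide
    rw [jacobiSym.mul_left, h2] at h1
    linarith
  have hJ : J(-((8 * v + 3 : ℕ) : ℤ) | q) = 1 := by
    rw [jacobiSym.neg _ hqodd]
    rcases Nat.odd_mod_four_iff.1 (Nat.odd_iff.1 hqodd) with h | h
    · rw [ZMod.χ₄_nat_one_mod_four h, one_mul,
        jacobiSym.quadratic_reciprocity_one_mod_four' hb h, hqb]
    · rw [ZMod.χ₄_nat_three_mod_four h,
        jacobiSym.quadratic_reciprocity_three_mod_four (by lia) h, hqb]
      norm_num
  obtain ⟨t, ht⟩ := exists_dvd_sq_add_of_jacobiSym_neg hq hJ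
  -- The modulus is `2q`: replacing an even root `t` by `t + q` makes it odd, which settles
  -- divisibility by `2`.
  obtain ⟨s, hs2, hs⟩ : ∃ s : ℤ, (2 : ℤ) ∣ s ^ 2 + (8 * v + 3 : ℕ) ∧
      (q : ℤ) ∣ s ^ 2 + (8 * v + 3 : ℕ) := by
    have hodd : ∀ s : ℤ, Odd s → (2 : ℤ) ∣ s ^ 2 + (8 * v + 3 : ℕ) := fun s hs =>
      (hs.pow.add_odd (by exact_mod_cast hb)).two_dvd
    rcases Int.even_or_odd t with h | h
    · refine ⟨t + q, hodd _ (h.add_odd (by exact_mod_cast hqodd)), ?_⟩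
      have : (t + q) ^ 2 + ((8 * v + 3 : ℕ) : ℤ) =
        (t ^ 2 + (8 * v + 3 : ℕ)) + q * (2 * t + q) := by ring
      rw [this]
      exact dvd_add ht (dvd_mul_right _ _)
    · exact ⟨t, hodd t h, ht⟩
  have hcop2 : IsCoprime (2 : ℤ) q := by
    exact_mod_cast Nat.isCoprime_iff_coprime.2 (Nat.coprime_two_left.2 hqodd)
  have := hcop2.mul_dvd hs2 hs
  rw [hqZ] at this
  exact sum_three_squares_of_dvd (by positivity)
    (by rw [← hqZ]; exact_mod_cast Nat.mul_pos two_pos hq.pos) this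

/-- In `4k + 1 = u² + v² + w²` exactly one of the squares is odd; its root is `2x + 1`. -/
theorem exists_sum_two_sq_add_pronic (k : ℕ) : ∃ x y z : ℤ, (k : ℤ) = x ^ 2 + x + y ^ 2 + z ^ 2 := by
  obtain ⟨u, v, w, h⟩ := sum_three_squares_of_mod_four_eq_one (N := 4 * k + 1) (by lia)
  have aux : ∀ u v w : ℤ, Odd u → ((4 * k + 1 : ℕ) : ℤ) = u ^ 2 + v ^ 2 + w ^ 2 →
      ∃ x y z : ℤ, (k : ℤ) = x ^ 2 + x + y ^ 2 + z ^ 2 := by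
    rintro _ v w ⟨x, rfl⟩ h
    push_cast at h
    rcases Int.even_or_odd' v with ⟨y, rfl | rfl⟩ <;>
      rcases Int.even_or_odd' w with ⟨z, rfl | rfl⟩
    · exact ⟨x, y, z, by linarith⟩
    all_goals ring_nf at h; lia
  by_cases hu : Odd u
  · exact aux u v w hu h
  by_cases hv : Odd v
  · exact aux v u w hv (by linarith)
  by_cases hw : Odd w
  · exact aux w u v hw (by linarith)
  rw [Int.not_odd_iff_even, even_iff_two_dvd] at hu hv hw
  have : (2 : ℤ) ∣ (4 * k + 1 : ℕ) := by
    rw [h]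
    exact dvd_add (dvd_add (dvd_pow hu two_ne_zero) (dvd_pow hv two_ne_zero))
      (dvd_pow hw two_ne_zero)
  lia

/-- One of `m`, `m - d`, `m - 2d` is `1` or `2` modulo 4, hence a sum of three squares; each
subtracted `d` is restored by some `yᵢ = 1`. -/
theorem exists_sum_three_norms {d m : ℕ} (hd : d % 4 = 1 ∨ d % 4 = 2) (hm : 2 * d ≤ m) :
    ∃ x₁ x₂ x₃ y₁ y₂ : ℤ,
      (m : ℤ) = (x₁ ^ 2 + d * y₁ ^ 2) + (x₂ ^ 2 + d * y₂ ^ 2) + x₃ ^ 2 := by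
  have key : ∀ N : ℕ, N % 4 = 1 ∨ N % 4 = 2 → ∃ u v w : ℤ, (N : ℤ) = u ^ 2 + v ^ 2 + w ^ 2 :=
    fun N hN => hN.elim sum_three_squares_of_mod_four_eq_one sum_three_squares_of_mod_four_eq_two
  by_cases h0 : m % 4 = 1 ∨ m % 4 = 2
  · obtain ⟨u, v, w, h⟩ := key m h0
    exact ⟨u, v, w, 0, 0, by linarith⟩
  by_cases h1 : (m - d) % 4 = 1 ∨ (m - d) % 4 = 2
  · obtain ⟨u, v, w, h⟩ := key (m - d) h1
    rw [Nat.cast_sub (by lia)] at h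
    exact ⟨u, v, w, 1, 0, by linarith⟩
  obtain ⟨u, v, w, h⟩ := key (m - 2 * d) (by lia)
  rw [Nat.cast_sub hm] at h
  push_cast at h
  exact ⟨u, v, w, 1, 1, by linarith⟩

theorem exists_small_solution {p : ℕ} (hp : p.Prime) (hp2 : p ≠ 2) {u : ℤ} (hu : ¬ (p : ℤ) ∣ u)
    (s : ℤ) : ∃ x : ℤ, (p : ℤ) ∣ s - u * x ∧ 2 * |x| ≤ p - 1 := by
  obtain ⟨e, f, hef⟩ := ((Nat.prime_iff_prime_int.1 hp).coprime_iff_not_dvd.2 hu)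
  obtain ⟨k, hk⟩ := (f * s).exists_four_mul_add_mul_sq_le (a := p) (by exact_mod_cast hp.pos)
  refine ⟨f * s + p * k, ⟨s * e - u * k, by linear_combination (-s) * hef⟩, ?_⟩
  generalize f * s + p * k = x at hk
  have h1 : |2 * x| ≤ |(p : ℤ)| := sq_le_sq.1 (by linarith)
  rw [abs_mul, abs_two, Nat.abs_cast] at h1
  have := hp.eq_two_or_odd
  lia

/-! ### Algebraic integers of `ℚ(√-d)` -/

namespace ImQuadField

variable {d : ℕ} [NeZero d]

theorem mul_star_self (z : ImQuadField d) :
    z * star z = algebraMap ℚ (ImQuadField d) (z.re ^ 2 + d * z.im ^ 2) := by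
  rw [← QuadraticAlgebra.algebraMap_norm_eq_mul_star, QuadraticAlgebra.norm_def]
  congr 1
  ring

theorem isIntegral_mk_intCast (a b : ℤ) :
    IsIntegral ℤ (⟨a, b⟩ : ImQuadField d) := by
  have h1 : IsIntegral ℤ (⟨0, 1⟩ : ImQuadField d) := by
    refine IsIntegral.of_pow (n := 2) two_pos ?_
    have : (⟨0, 1⟩ : ImQuadField d) ^ 2 = ((-d : ℤ) : ImQuadField d) := by
      rw [sq]; ext <;> simp
    rw [this]
    exact isIntegral_intCast _
  have h2 : (⟨a, b⟩ : ImQuadField d) = (a : ImQuadField d) + (b : ImQuadField d) * ⟨0, 1⟩ := by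
    ext <;> simp
  rw [h2]
  exact (isIntegral_intCast _).add ((isIntegral_intCast _).mul h1)

theorem isIntegral_half (hd : d % 4 = 3) (x : ℤ) :
    IsIntegral ℤ (⟨x + 1 / 2, 1 / 2⟩ : ImQuadField d) := by
  have h1 : IsIntegral ℤ (⟨1 / 2, 1 / 2⟩ : ImQuadField d) := by
    obtain ⟨e, he⟩ : ∃ e, d + 1 = 4 * e := ⟨(d + 1) / 4, by lia⟩
    have he' : (d : ℚ) + 1 = 4 * e := by exact_mod_cast he
    refine ⟨.X ^ 2 - .X + .C (e : ℤ), by monicity!, ?_⟩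
    simp only [Polynomial.eval₂_add, Polynomial.eval₂_sub, Polynomial.eval₂_X,
      Polynomial.eval₂_C, sq]
    ext <;> simp
    · linarith
    · norm_num
  have h2 : (⟨x + 1 / 2, 1 / 2⟩ : ImQuadField d) = (x : ImQuadField d) + ⟨1 / 2, 1 / 2⟩ := by
    ext <;> simp
  rw [h2]
  exact (isIntegral_intCast _).add h1

end ImQuadField

theorem Rat.exists_int_of_squarefree_mul_sq {d : ℕ} (hd : Squarefree d) {t : ℚ} {k : ℤ}
    (h : (d : ℚ) * t ^ 2 = k) : ∃ b : ℤ, t = b := by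
  have h1 : (d : ℤ) * t.num ^ 2 = k * t.den ^ 2 := by
    have hne : (t.den : ℚ) ≠ 0 := by exact_mod_cast t.den_ne_zero
    have : (d : ℚ) * t.num ^ 2 = k * t.den ^ 2 := by
      rw [← h, mul_assoc, ← mul_pow, Rat.mul_den_eq_num]
    exact_mod_cast this
  have h2 : ((t.den : ℤ) ^ 2) ∣ d * t.num ^ 2 := ⟨k, by linarith⟩
  have h3 : IsCoprime ((t.den : ℤ) ^ 2) (t.num ^ 2) :=
    (Int.isCoprime_iff_gcd_eq_one.2 (by simpa [Int.gcd] using t.reduced.symm)).pow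
  have h4 : t.den ^ 2 ∣ d := by exact_mod_cast h3.dvd_of_dvd_mul_right h2
  have h5 : t.den = 1 := Nat.isUnit_iff.1 (hd _ (by rwa [← sq]))
  exact ⟨t.num, by rw [← Rat.mul_den_eq_num t, h5]; simp⟩

/-- Used with `u = 2` and `v = p`, this separates the denominator `2` of integers of `E` from the
denominator `p`. -/
theorem IsIntegral.of_coprime_mul {E : Type*} [CommRing E] {u v : ℤ} (huv : IsCoprime u v) {x : E}
    (hu : IsIntegral ℤ (u * x)) (hv : IsIntegral ℤ (v * x)) : IsIntegral ℤ x := by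
  obtain ⟨e, f, h⟩ := huv
  have h' : (e : E) * u + f * v = 1 := by exact_mod_cast congrArg (Int.cast : ℤ → E) h
  have : x = e * (u * x) + f * (v * x) := by linear_combination (-x) * h'
  rw [this]
  exact ((isIntegral_intCast _).mul hu).add ((isIntegral_intCast _).mul hv)

namespace ImQuadField

variable {d : ℕ} [NeZero d]

/-- Trace and norm of `z` are integers, and `d (2 im z)² = 4 N(z) - Tr(z)²`; as `d` is square-free,
`2 im z` has denominator one. This coarse description covers every `d` modulo 4 at once. -/
theorem exists_int_coords (hd : Squarefree d) {z : ImQuadField d} (hz : IsIntegral ℤ z) :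
    ∃ a b : ℤ, 2 * z = ⟨a, b⟩ := by
  have hinj := (algebraMap ℚ (ImQuadField d)).injective
  have hs : IsIntegral ℤ (star z) := hz.map (starRingEnd (ImQuadField d)).toIntAlgHom
  have htr : algebraMap ℚ (ImQuadField d) (2 * z.re) = z + star z := by
    ext <;> simp [two_mul]
  have h1 : IsIntegral ℤ (2 * z.re) :=
    (isIntegral_algebraMap_iff hinj).1 (htr ▸ hz.add hs)
  have h2 : IsIntegral ℤ (z.re ^ 2 + d * z.im ^ 2) :=
    (isIntegral_algebraMap_iff hinj).1 (mul_star_self z ▸ hz.mul hs)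
  obtain ⟨a, ha⟩ := IsIntegrallyClosed.isIntegral_iff.1 h1
  obtain ⟨k, hk⟩ := IsIntegrallyClosed.isIntegral_iff.1 h2
  simp only [eq_intCast] at ha hk
  obtain ⟨b, hb⟩ := Rat.exists_int_of_squarefree_mul_sq hd (t := 2 * z.im) (k := 4 * k - a ^ 2)
    (by push_cast; rw [ha, hk]; ring)
  refine ⟨a, b, ?_⟩
  rw [two_mul]
  ext
  · simp [ha, two_mul]
  · simp [← hb, two_mul]

end ImQuadField

theorem mem_stdLattice {E : Type*} [Field E] {m : ℕ} {x : Fin m → E} (hx : ∀ i, IsIntegral ℤ (x i)) :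
    x ∈ stdLattice E m := by
  rw [stdLattice, Submodule.mem_span_range_iff_exists_fun]
  have hy : ∀ i, ∃ y : 𝓞 E, (y : E) = x i := fun i => ⟨⟨x i, hx i⟩, rfl⟩
  choose y hy using hy
  refine ⟨y, ?_⟩
  ext j
  simp only [Finset.sum_apply, Pi.smul_apply, Pi.single_apply, smul_ite, smul_zero,
    Finset.sum_ite_eq, Finset.mem_univ, if_true]
  rw [Algebra.smul_def, mul_one, ← hy j]

/-! ### Representations of a unary lattice by `I_m` -/

section Representation

variable {E V : Type*} [Field E] [StarRing E] [AddCommGroup V] [Module E V] [Module (𝓞 E) V]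
  [IsScalarTower (𝓞 E) E V]

/-- The representation is `αv ↦ αw`. Non-vanishing of `h(v, v)` forces `v, w ≠ 0`, which makes `α`
recoverable from `αv` and from `αw`. -/
theorem isRepresentedBy_stdLattice (h : HermitianMap E V) (𝔄 : Ideal (𝓞 E)) {v : V}
    (hv : h.form v v ≠ 0) {m : ℕ} (w : Fin m → E)
    (hint : ∀ α ∈ 𝔄, ∀ i, IsIntegral ℤ ((α : E) * w i))
    (hw : h.form v v = ∑ i, w i * star (w i)) :
    IsRepresentedBy h (unaryLattice 𝔄 v) (stdHermitianMap E m) (stdLattice E m) := by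
  have hv0 : v ≠ 0 := by rintro rfl; simp at hv
  have hw0 : w ≠ 0 := by rintro rfl; simp [hw] at hv
  have hsmul (α : 𝓞 E) (x : V) : α • x = (α : E) • x := (algebraMap_smul E α x).symm
  have hsmul' (α : 𝓞 E) : α • w = (α : E) • w := (algebraMap_smul E α w).symm
  have hinj : Function.Injective (LinearMap.toSpanSingleton (𝓞 E) V v) := by
    intro α β hαβ
    simp only [LinearMap.toSpanSingleton_apply, hsmul] at hαβ
    exact NumberField.RingOfIntegers.ext (smul_left_injective E hv0 hαβ)
  let e : 𝔄 ≃ₗ[𝓞 E] unaryLattice 𝔄 v :=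
    Submodule.equivMapOfInjective (LinearMap.toSpanSingleton (𝓞 E) V v) hinj 𝔄
  have he (α : 𝔄) : (e α : V) = (α : 𝓞 E) • v := rfl
  let τ : 𝔄 →ₗ[𝓞 E] stdLattice E m :=
    LinearMap.codRestrict _ ((LinearMap.toSpanSingleton (𝓞 E) (Fin m → E) w).domRestrict 𝔄)
      fun α => mem_stdLattice fun i => by
        have := hint α α.2 i
        rwa [← smul_eq_mul, ← Pi.smul_apply, ← hsmul'] at this
  have hτ (α : 𝔄) : (τ α : Fin m → E) = (α : 𝓞 E) • w := rfl
  refine ⟨τ ∘ₗ e.symm.toLinearMap, ?_, fun x y => ?_⟩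
  · have hτinj : Function.Injective τ := by
      intro α β hαβ
      have := congrArg (Subtype.val : stdLattice E m → Fin m → E) hαβ
      rw [hτ, hτ, hsmul', hsmul'] at this
      exact Subtype.ext (NumberField.RingOfIntegers.ext (smul_left_injective E hw0 this))
    exact hτinj.comp e.symm.injective
  · obtain ⟨α, rfl⟩ := e.surjective x
    obtain ⟨β, rfl⟩ := e.surjective y
    simp only [LinearMap.comp_apply, LinearEquiv.coe_coe, LinearEquiv.symm_apply_apply, he, hτ,
      hsmul, hsmul', map_smul, map_smulₛₗ, LinearMap.smul_apply, hw]
    congr 2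

end Representation

namespace NumberField.RingOfIntegers

variable {K : Type*} [Field K]

theorem coe_mul (x y : 𝓞 K) : ((x * y : 𝓞 K) : K) = x * y := map_mul _ _ _

theorem coe_sub (x y : 𝓞 K) : ((x - y : 𝓞 K) : K) = x - y := map_sub _ _ _

theorem coe_intCast (k : ℤ) : ((k : 𝓞 K) : K) = k := map_intCast _ _

theorem coe_natCast (k : ℕ) : ((k : 𝓞 K) : K) = k := map_natCast _ _

theorem coe_two : ((2 : 𝓞 K) : K) = 2 := map_ofNat _ _

theorem exists_coe_eq {x : K} (hx : IsIntegral ℤ x) : ∃ y : 𝓞 K, (y : K) = x := ⟨⟨x, hx⟩, rfl⟩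

end NumberField.RingOfIntegers

open NumberField.RingOfIntegers

/-! ### Multipliers of `𝔓` with denominator `p` or `2p` -/

namespace ImQuadField

variable {d p : ℕ} [NeZero d] {𝔓 : Ideal (𝓞 (ImQuadField d))}

theorem intCast_mem_iff_of_under_eq (h𝔓p : 𝔓.under ℤ = Ideal.span {(p : ℤ)}) (k : ℤ) :
    (k : 𝓞 (ImQuadField d)) ∈ 𝔓 ↔ (p : ℤ) ∣ k := by
  rw [← Ideal.mem_span_singleton, ← h𝔓p, Ideal.under_def, Ideal.mem_comap, eq_intCast]

theorem dvd_of_coe_mem (h𝔓p : 𝔓.under ℤ = Ideal.span {(p : ℤ)}) {γ : 𝓞 (ImQuadField d)}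
    (hγ : γ ∈ 𝔓) {k : ℤ} (h : (γ : ImQuadField d) = k) : (p : ℤ) ∣ k := by
  rw [← intCast_mem_iff_of_under_eq h𝔓p]
  have : γ = (k : 𝓞 (ImQuadField d)) := NumberField.RingOfIntegers.ext (by rw [h, coe_intCast])
  rwa [← this]

/-- If the prime `𝔓` above the odd prime `p` is not generated by `p`, then it contains an element
`a + b √-d` with `b` prime to `p`. -/
theorem exists_mem_not_dvd (hd : Squarefree d) (hp : p.Prime) (hp2 : p ≠ 2)
    (h𝔓np : ¬ 𝔓.IsPrincipal) (h𝔓p : 𝔓.under ℤ = Ideal.span {(p : ℤ)}) :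
    ∃ α ∈ 𝔓, ∃ a b : ℤ, (α : ImQuadField d) = ⟨a, b⟩ ∧ ¬ (p : ℤ) ∣ b ∧
      (p : ℤ) ∣ a ^ 2 + d * b ^ 2 := by
  have hpZ := Nat.prime_iff_prime_int.1 hp
  have hpne : (p : ImQuadField d) ≠ 0 := Nat.cast_ne_zero.2 hp.ne_zero
  have hpmem : (p : 𝓞 (ImQuadField d)) ∈ 𝔓 := by
    simpa using (intCast_mem_iff_of_under_eq h𝔓p p).2 dvd_rfl
  by_contra! hcon
  -- Otherwise `p` divides both coordinates of `2α` for every `α ∈ 𝔓`, so `α/p` is integral and `𝔓`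
  -- is generated by `p`.
  refine h𝔓np ⟨⟨(p : 𝓞 (ImQuadField d)), le_antisymm (fun α hα => ?_) ?_⟩⟩
  · obtain ⟨a, b, hab⟩ := exists_int_coords hd α.isIntegral_coe
    have hnorm : (p : ℤ) ∣ a ^ 2 + d * b ^ 2 := by
      obtain ⟨β, hβ⟩ := exists_coe_eq (isIntegral_mk_intCast (d := d) a (-b))
      refine dvd_of_coe_mem h𝔓p (𝔓.mul_mem_left β (𝔓.mul_mem_left 2 hα)) ?_
      rw [coe_mul, coe_mul, coe_two, hab, hβ]
      ext <;> simp only [QuadraticAlgebra.re_mul, QuadraticAlgebra.im_mul,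
        QuadraticAlgebra.re_intCast, QuadraticAlgebra.im_intCast] <;> push_cast <;> ring
    have hb : (p : ℤ) ∣ b := by
      by_contra hb
      exact hcon (2 * α) (𝔓.mul_mem_left _ hα) a b (by rw [coe_mul, coe_two, hab]) hb hnorm
    have ha : (p : ℤ) ∣ a := by
      refine hpZ.dvd_of_dvd_pow (n := 2) ((dvd_add_left ?_).1 hnorm)
      exact dvd_mul_of_dvd_right (dvd_pow hb two_ne_zero) _
    obtain ⟨a', rfl⟩ := ha
    obtain ⟨b', rfl⟩ := hb
    have hint : IsIntegral ℤ ((α : ImQuadField d) / p) := by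
      refine IsIntegral.of_coprime_mul (u := 2) (v := p) ?_ ?_ ?_
      · exact_mod_cast Nat.isCoprime_iff_coprime.2
          (Nat.coprime_two_left.2 (hp.odd_of_ne_two hp2))
      · have : ((2 : ℤ) : ImQuadField d) * (α / p) = ⟨a', b'⟩ := by
          rw [← mul_div_assoc, div_eq_iff hpne, Int.cast_ofNat]
          rw [hab]
          ext <;> simp <;> ring
        rw [this]
        exact isIntegral_mk_intCast _ _
      · have : ((p : ℤ) : ImQuadField d) * (α / p) = α := by
          rw [Int.cast_natCast, mul_div_cancel₀ _ hpne]
        rw [this]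
        exact α.isIntegral_coe
    obtain ⟨β, hβ⟩ := exists_coe_eq hint
    refine Ideal.mem_span_singleton.2 ⟨β, NumberField.RingOfIntegers.ext ?_⟩
    rw [coe_mul, coe_natCast, hβ, mul_div_cancel₀ _ hpne]
  · exact (Ideal.span_singleton_le_iff_mem _).2 hpmem

/-- If `n² ≡ -d` modulo `p`, then for `t = n` or `t = -n` multiplication by `t - √-d` maps
`𝔓` into `p 𝓞`. -/
theorem exists_mul_isIntegral (hd : Squarefree d) (hp : p.Prime) (hp2 : p ≠ 2)
    (h𝔓np : ¬ 𝔓.IsPrincipal) (h𝔓p : 𝔓.under ℤ = Ideal.span {(p : ℤ)}) {n : ℤ}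
    (hn : (p : ℤ) ∣ n ^ 2 + d) :
    ∃ t : ℤ, |t| = |n| ∧
      ∀ γ ∈ 𝔓, IsIntegral ℤ ((γ : ImQuadField d) * ⟨(t : ℚ) / p, -1 / p⟩) := by
  have hpZ := Nat.prime_iff_prime_int.1 hp
  have hpQ : (p : ℚ) ≠ 0 := Nat.cast_ne_zero.2 hp.ne_zero
  obtain ⟨α, hα, a, b, hab, hb, hnorm⟩ := exists_mem_not_dvd hd hp hp2 h𝔓np h𝔓p
  obtain ⟨t, ht, hat⟩ : ∃ t : ℤ, |t| = |n| ∧ (p : ℤ) ∣ a - t * b := by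
    have h1 : (p : ℤ) ∣ (a - n * b) * (a - -n * b) := by
      have : (a - n * b) * (a - -n * b) = (a ^ 2 + d * b ^ 2) - (n ^ 2 + d) * b ^ 2 := by ring
      rw [this]
      exact dvd_sub hnorm (dvd_mul_of_dvd_left hn _)
    rcases hpZ.dvd_or_dvd h1 with h | h
    · exact ⟨n, rfl, h⟩
    · exact ⟨-n, abs_neg n, h⟩
  refine ⟨t, ht, fun γ hγ => ?_⟩
  have htd : (p : ℤ) ∣ t ^ 2 + d := by rwa [← sq_abs, ht, sq_abs]
  obtain ⟨a', b', hab'⟩ := exists_int_coords hd γ.isIntegral_coe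
  have h2 : (p : ℤ) ∣ b * a' - b' * a := by
    -- Eliminating `√-d` between `2γ` and `α` leaves a rational integer in `𝔓`, so every element of
    -- `𝔓` satisfies the congruence `a' ≡ tb'` that `α` does.
    have hmem : (b : 𝓞 (ImQuadField d)) * (2 * γ) - (b' : 𝓞 (ImQuadField d)) * α ∈ 𝔓 :=
      𝔓.sub_mem (𝔓.mul_mem_left _ (𝔓.mul_mem_left _ hγ)) (𝔓.mul_mem_left _ hα)
    refine dvd_of_coe_mem h𝔓p hmem ?_
    rw [coe_sub, coe_mul, coe_mul, coe_mul, coe_two, coe_intCast, coe_intCast, hab, hab']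
    ext <;> simp
    ring
  have h3 : (p : ℤ) ∣ a' - t * b' := by
    refine (hpZ.dvd_or_dvd (?_ : (p : ℤ) ∣ b * (a' - t * b'))).resolve_left hb
    have : b * (a' - t * b') = (b * a' - b' * a) + b' * (a - t * b) := by ring
    rw [this]
    exact dvd_add h2 (dvd_mul_of_dvd_right hat _)
  obtain ⟨u, hu⟩ := h3
  obtain ⟨c, hc⟩ := htd
  refine IsIntegral.of_coprime_mul (u := 2) (v := p) ?_ ?_ ?_
  · exact_mod_cast Nat.isCoprime_iff_coprime.2
      (Nat.coprime_two_left.2 (hp.odd_of_ne_two hp2))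
  · have : ((2 : ℤ) : ImQuadField d) * (γ * ⟨(t : ℚ) / p, -1 / p⟩) =
        ⟨((t * u + b' * c : ℤ) : ℚ), ((-u : ℤ) : ℚ)⟩ := by
      rw [← mul_assoc, Int.cast_ofNat]
      have huQ : (a' : ℚ) - t * b' = p * u := by exact_mod_cast hu
      have hcQ : (t : ℚ) ^ 2 + d = p * c := by exact_mod_cast hc
      rw [hab']
      ext <;> simp <;> field_simp
      · linear_combination t * huQ + b' * hcQ
      · linear_combination -huQ
    rw [this]
    exact isIntegral_mk_intCast _ _
  · have : ((p : ℤ) : ImQuadField d) * (γ * ⟨(t : ℚ) / p, -1 / p⟩) =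
        γ * ⟨(t : ℤ), ((-1 : ℤ) : ℚ)⟩ := by
      rw [mul_left_comm]
      congr 1
      ext <;> simp <;> field_simp
    rw [this]
    exact γ.isIntegral_coe.mul (isIntegral_mk_intCast _ _)

/-- For odd `t` and `d ≡ 3 (mod 4)`, `(t - √-d)/2` is itself integral, which gains the extra factor
`2` in the denominator. -/
theorem exists_mul_isIntegral_half (hd : Squarefree d) (hd4 : d % 4 = 3) (hp : p.Prime)
    (hp2 : p ≠ 2) (h𝔓np : ¬ 𝔓.IsPrincipal) (h𝔓p : 𝔓.under ℤ = Ideal.span {(p : ℤ)}) {n : ℤ}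
    (hn : (p : ℤ) ∣ n ^ 2 + d) (hodd : Odd n) :
    ∃ t : ℤ, |t| = |n| ∧
      ∀ γ ∈ 𝔓, IsIntegral ℤ ((γ : ImQuadField d) * ⟨(t : ℚ) / (2 * p), -1 / (2 * p)⟩) := by
  have hpQ : (p : ℚ) ≠ 0 := Nat.cast_ne_zero.2 hp.ne_zero
  obtain ⟨t, ht, h⟩ := exists_mul_isIntegral hd hp hp2 h𝔓np h𝔓p hn
  refine ⟨t, ht, fun γ hγ => ?_⟩
  obtain ⟨s, hs⟩ : Odd t := by rwa [← odd_abs, ht, odd_abs]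
  refine IsIntegral.of_coprime_mul (u := 2) (v := p) ?_ ?_ ?_
  · exact_mod_cast Nat.isCoprime_iff_coprime.2
      (Nat.coprime_two_left.2 (hp.odd_of_ne_two hp2))
  · have : ((2 : ℤ) : ImQuadField d) * (γ * ⟨(t : ℚ) / (2 * p), -1 / (2 * p)⟩) =
        γ * ⟨(t : ℚ) / p, -1 / p⟩ := by
      rw [mul_left_comm]
      congr 1
      rw [Int.cast_ofNat, two_mul]
      ext <;> simp <;> field_simp <;> norm_num
    rw [this]
    exact h γ hγ
  · have : ((p : ℤ) : ImQuadField d) * (γ * ⟨(t : ℚ) / (2 * p), -1 / (2 * p)⟩) =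
        γ * ((t : ImQuadField d) - ⟨(s : ℚ) + 1 / 2, 1 / 2⟩) := by
      rw [mul_left_comm]
      congr 1
      have hsQ : (t : ℚ) = 2 * s + 1 := by exact_mod_cast hs
      ext <;> simp [hsQ] <;> field_simp
      ring
    rw [this]
    exact γ.isIntegral_coe.mul ((isIntegral_intCast _).sub (isIntegral_half hd4 s))

/-- Divide `a² + db² ≡ 0` by `b²` modulo `p`, with `f` the inverse of `b`; `p ∤ d` keeps the root
non-zero. -/
theorem exists_pos_sq_modEq (hd : Squarefree d) (hp : p.Prime) (hp2 : p ≠ 2) (hpd : ¬ p ∣ d)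
    (h𝔓np : ¬ 𝔓.IsPrincipal) (h𝔓p : 𝔓.under ℤ = Ideal.span {(p : ℤ)}) :
    ∃ k : ℕ, 0 < k ∧ -(d : ℤ) ≡ (k : ℤ) ^ 2 [ZMOD p] := by
  have hpZ := Nat.prime_iff_prime_int.1 hp
  obtain ⟨-, -, a, b, -, hb, hnorm⟩ := exists_mem_not_dvd hd hp hp2 h𝔓np h𝔓p
  obtain ⟨e, f, hef⟩ := hpZ.coprime_iff_not_dvd.2 hb
  have hdvd : (p : ℤ) ∣ (a * f) ^ 2 + d := by
    have : (a * f) ^ 2 + d = (a ^ 2 + d * b ^ 2) * f ^ 2 + p * (e * d * (1 + f * b)) := by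
      linear_combination (-d * (1 + f * b)) * hef
    rw [this]
    exact dvd_add (dvd_mul_of_dvd_left hnorm _) (dvd_mul_right _ _)
  refine ⟨(a * f).natAbs, Nat.pos_of_ne_zero fun h0 => hpd ?_, Int.modEq_iff_dvd.2 ?_⟩
  · rw [Int.natAbs_eq_zero.1 h0] at hdvd
    simpa [Int.natCast_dvd_natCast] using hdvd
  · rwa [Int.natCast_natAbs, sq_abs, sub_neg_eq_add]

theorem exists_isLeast_sq_modEq (hd : Squarefree d) (hp : p.Prime) (hp2 : p ≠ 2) (hpd : ¬ p ∣ d)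
    (h𝔓np : ¬ 𝔓.IsPrincipal) (h𝔓p : 𝔓.under ℤ = Ideal.span {(p : ℤ)}) :
    ∃ n : ℕ, IsLeast {k : ℕ | 0 < k ∧ -(d : ℤ) ≡ (k : ℤ) ^ 2 [ZMOD p]} n :=
  ⟨_, Nat.sInf_mem (exists_pos_sq_modEq hd hp hp2 hpd h𝔓np h𝔓p), fun _ h => Nat.sInf_le h⟩

theorem exists_isLeast_odd_sq_modEq (hd : Squarefree d) (hp : p.Prime) (hp2 : p ≠ 2)
    (hpd : ¬ p ∣ d) (h𝔓np : ¬ 𝔓.IsPrincipal) (h𝔓p : 𝔓.under ℤ = Ideal.span {(p : ℤ)}) :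
    ∃ n : ℕ, IsLeast {k : ℕ | 0 < k ∧ Odd k ∧ -(d : ℤ) ≡ (k : ℤ) ^ 2 [ZMOD p]} n := by
  have hne : {k : ℕ | 0 < k ∧ Odd k ∧ -(d : ℤ) ≡ (k : ℤ) ^ 2 [ZMOD p]}.Nonempty := by
    obtain ⟨k, hk, hmod⟩ := exists_pos_sq_modEq hd hp hp2 hpd h𝔓np h𝔓p
    rcases Nat.even_or_odd k with h | h
    -- Adding the odd number `p` changes the parity of a root but not its residue.
    · refine ⟨k + p, by lia, h.add_odd (hp.odd_of_ne_two hp2), hmod.trans ?_⟩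
      exact Int.modEq_iff_dvd.2 ⟨2 * k + p, by push_cast; ring⟩
    · exact ⟨k, hk, h, hmod⟩
  exact ⟨_, Nat.sInf_mem hne, fun _ h => Nat.sInf_le h⟩

end ImQuadField

/-! ### The two cases of the theorem -/

namespace ImQuadField

variable {d p : ℕ} [NeZero d] {𝔓 : Ideal (𝓞 (ImQuadField d))}

theorem isRepresentedBy_stdLattice_four {V : Type*} [AddCommGroup V] [Module (ImQuadField d) V]
    [Module (𝓞 (ImQuadField d)) V] [IsScalarTower (𝓞 (ImQuadField d)) (ImQuadField d) V]
    (h : HermitianMap (ImQuadField d) V) (hp : p ≠ 0) {r : ℕ} (hr : 0 < r) {v : V}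
    (hv : h.form v v = (r : ImQuadField d) / (p : ImQuadField d)) (w₀ w₁ w₂ w₃ : ImQuadField d)
    (h₀ : ∀ γ ∈ 𝔓, IsIntegral ℤ ((γ : ImQuadField d) * w₀))
    (h₁ : IsIntegral ℤ w₁) (h₂ : IsIntegral ℤ w₂) (h₃ : IsIntegral ℤ w₃)
    (hsum : (r : ℚ) / p = (w₀.re ^ 2 + d * w₀.im ^ 2) + (w₁.re ^ 2 + d * w₁.im ^ 2) +
      (w₂.re ^ 2 + d * w₂.im ^ 2) + (w₃.re ^ 2 + d * w₃.im ^ 2)) :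
    IsRepresentedBy h (unaryLattice 𝔓 v)
      (stdHermitianMap (ImQuadField d) 4) (stdLattice (ImQuadField d) 4) := by
  refine isRepresentedBy_stdLattice h 𝔓 ?_ ![w₀, w₁, w₂, w₃] (fun γ hγ i => ?_) ?_
  · rw [hv]
    exact div_ne_zero (Nat.cast_ne_zero.2 hr.ne') (Nat.cast_ne_zero.2 hp)
  · fin_cases i
    · exact h₀ γ hγ
    · exact γ.isIntegral_coe.mul h₁
    · exact γ.isIntegral_coe.mul h₂
    · exact γ.isIntegral_coe.mul h₃
  · have hrp : (r : ImQuadField d) / (p : ImQuadField d) =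
        algebraMap ℚ (ImQuadField d) ((r : ℚ) / p) := by
      rw [map_div₀, map_natCast, map_natCast]
    rw [hv, hrp, hsum, Fin.sum_univ_four, map_add, map_add, map_add]
    simp only [← mul_star_self]
    rfl

theorem isRepresentedBy_of_mod_four_eq_one_or_two (hd : Squarefree d)
    (hd4 : d % 4 = 1 ∨ d % 4 = 2) (hp : p.Prime) (hp2 : p ≠ 2) (hpd : ¬ p ∣ d)
    (h𝔓np : ¬ 𝔓.IsPrincipal) (h𝔓p : 𝔓.under ℤ = Ideal.span {(p : ℤ)})
    {V : Type*} [AddCommGroup V] [Module (ImQuadField d) V] [Module (𝓞 (ImQuadField d)) V]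
    [IsScalarTower (𝓞 (ImQuadField d)) (ImQuadField d) V]
    (h : HermitianMap (ImQuadField d) V) {n : ℕ} (hn : -(d : ℤ) ≡ (n : ℤ) ^ 2 [ZMOD p])
    {r : ℕ} (hr : 0 < r)
    (hC : (p : ℚ) * (p - 1) ^ 2 / 4 + (p - 1) * n + (d + n ^ 2) / p + 2 * p * d ≤ r)
    {v : V} (hv : h.form v v = (r : ImQuadField d) / (p : ImQuadField d)) :
    IsRepresentedBy h (unaryLattice 𝔓 v)
      (stdHermitianMap (ImQuadField d) 4) (stdLattice (ImQuadField d) 4) := by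
  have hpZ := Nat.prime_iff_prime_int.1 hp
  have hpQ : (p : ℚ) ≠ 0 := Nat.cast_ne_zero.2 hp.ne_zero
  have hp0 : (0 : ℤ) < p := by exact_mod_cast hp.pos
  have hn' : (p : ℤ) ∣ (n : ℤ) ^ 2 + d := by simpa using Int.modEq_iff_dvd.1 hn
  obtain ⟨t, ht, hint⟩ := exists_mul_isIntegral hd hp hp2 h𝔓np h𝔓p hn'
  rw [Nat.abs_cast] at ht
  obtain ⟨c, hc⟩ := hn'
  have hc' : t ^ 2 + d = p * c := by rw [← hc, ← ht, sq_abs]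
  have hpt : ¬ (p : ℤ) ∣ 2 * t := by
    intro hdvd
    rcases hpZ.dvd_or_dvd hdvd with h2 | h2
    · have : p ∣ 2 := by exact_mod_cast h2
      exact hp2 ((Nat.prime_dvd_prime_iff_eq hp Nat.prime_two).1 this)
    · have : (p : ℤ) ∣ d := (dvd_add_right (dvd_pow h2 two_ne_zero)).1 ⟨c, hc'⟩
      exact hpd (by exact_mod_cast this)
  -- With `w₀ = x + (t - √-d)/p`, `N(w₀) = x² + (2tx + c)/p`; this choice of `x` makes `r/p - N(w₀)
  -- = k - x²` an integer.
  obtain ⟨x, ⟨k, hk⟩, hx⟩ := exists_small_solution hp hp2 hpt (r - c)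
  have hC' : (p : ℤ) * (p - 1) ^ 2 + 4 * ((p - 1) * n) + 4 * c + 8 * (p * d) ≤ 4 * r := by
    have : ((d : ℚ) + n ^ 2) / p = c := by
      rw [div_eq_iff hpQ, add_comm, mul_comm]
      exact_mod_cast hc
    rw [this] at hC
    have : (p : ℚ) * (p - 1) ^ 2 + 4 * ((p - 1) * n) + 4 * c + 8 * (p * d) ≤ 4 * r := by linarith
    exact_mod_cast this
  have hx2 : 4 * x ^ 2 ≤ ((p : ℤ) - 1) ^ 2 := by
    have := pow_le_pow_left₀ (by positivity) hx 2
    rwa [mul_pow, sq_abs] at this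
  have htx : 2 * (t * x) ≤ (p - 1) * n := by
    calc 2 * (t * x) ≤ 2 * (|t| * |x|) := by rw [← abs_mul]; linarith [le_abs_self (t * x)]
      _ = (2 * |x|) * n := by rw [ht]; ring
      _ ≤ (p - 1) * n := by gcongr
  -- The four terms of `C` pay for `px²`, `2tx`, `c` and `p · 2d` in turn.
  have hm : 2 * (d : ℤ) ≤ k - x ^ 2 := by
    have h1 : (p : ℤ) * (4 * x ^ 2) ≤ p * (p - 1) ^ 2 := by gcongr
    refine le_of_mul_le_mul_left ?_ hp0
    linarith
  obtain ⟨m, hm'⟩ := Int.eq_ofNat_of_zero_le (show 0 ≤ k - x ^ 2 by lia)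
  rw [hm'] at hm
  obtain ⟨x₁, x₂, x₃, y₁, y₂, hsum⟩ := exists_sum_three_norms hd4 (by exact_mod_cast hm)
  refine isRepresentedBy_stdLattice_four h hp.ne_zero hr hv
    (x + ⟨(t : ℚ) / p, -1 / p⟩) ⟨x₁, y₁⟩ ⟨x₂, y₂⟩ ⟨x₃, (0 : ℤ)⟩ (fun γ hγ => ?_)
    (isIntegral_mk_intCast _ _) (isIntegral_mk_intCast _ _) (isIntegral_mk_intCast _ _) ?_
  · rw [mul_add]
    exact (γ.isIntegral_coe.mul (isIntegral_intCast _)).add (hint γ hγ)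
  · have hkQ : (r : ℚ) - c - 2 * t * x = p * k := by exact_mod_cast hk
    have hmQ : (k : ℚ) - x ^ 2 = (x₁ ^ 2 + d * y₁ ^ 2) + (x₂ ^ 2 + d * y₂ ^ 2) + x₃ ^ 2 := by
      exact_mod_cast hm'.trans hsum
    have hcQ : (t : ℚ) ^ 2 + d = p * c := by exact_mod_cast hc'
    simp only [QuadraticAlgebra.re_add, QuadraticAlgebra.im_add, QuadraticAlgebra.re_intCast,
      QuadraticAlgebra.im_intCast]
    push_cast
    field_simp
    linear_combination p * hkQ + p ^ 2 * hmQ - hcQ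

theorem isRepresentedBy_of_mod_four_eq_three (hd : Squarefree d)
    (hd4 : d % 4 = 3) (hp : p.Prime) (hp2 : p ≠ 2) (hpd : ¬ p ∣ d)
    (h𝔓np : ¬ 𝔓.IsPrincipal) (h𝔓p : 𝔓.under ℤ = Ideal.span {(p : ℤ)})
    {V : Type*} [AddCommGroup V] [Module (ImQuadField d) V] [Module (𝓞 (ImQuadField d)) V]
    [IsScalarTower (𝓞 (ImQuadField d)) (ImQuadField d) V]
    (h : HermitianMap (ImQuadField d) V) {n : ℕ} (hodd : Odd n)
    (hn : -(d : ℤ) ≡ (n : ℤ) ^ 2 [ZMOD p]) {r : ℕ} (hr : 0 < r)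
    (hC : (p : ℚ) * (p - 1) ^ 2 / 4 + (p - 1) * n + (d + n ^ 2) / p + p * (d + 1) / 4 ≤ r)
    {v : V} (hv : h.form v v = (r : ImQuadField d) / (p : ImQuadField d)) :
    IsRepresentedBy h (unaryLattice 𝔓 v)
      (stdHermitianMap (ImQuadField d) 4) (stdLattice (ImQuadField d) 4) := by
  have hpZ := Nat.prime_iff_prime_int.1 hp
  have hpQ : (p : ℚ) ≠ 0 := Nat.cast_ne_zero.2 hp.ne_zero
  have hp0 : (0 : ℤ) < p := by exact_mod_cast hp.pos
  have hn' : (p : ℤ) ∣ (n : ℤ) ^ 2 + d := by simpa using Int.modEq_iff_dvd.1 hn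
  obtain ⟨t, ht, hint⟩ := exists_mul_isIntegral_half hd hd4 hp hp2 h𝔓np h𝔓p hn'
    (by exact_mod_cast hodd)
  rw [Nat.abs_cast] at ht
  obtain ⟨e, he⟩ : ∃ e : ℕ, d + 1 = 4 * e := ⟨(d + 1) / 4, by lia⟩
  obtain ⟨c, hc⟩ : (4 * p : ℤ) ∣ (n : ℤ) ^ 2 + d := by
    refine IsCoprime.mul_dvd ?_ ?_ hn'
    · have h2 : Nat.Coprime (2 ^ 2) p :=
        (Nat.coprime_two_left.2 (hp.odd_of_ne_two hp2)).pow_left 2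
      exact_mod_cast Nat.isCoprime_iff_coprime.2 h2
    · obtain ⟨s, rfl⟩ := hodd
      exact ⟨s ^ 2 + s + e, by push_cast; linarith⟩
  have hc' : t ^ 2 + d = 4 * p * c := by rw [← hc, ← ht, sq_abs]
  have hc0 : 0 ≤ c := by
    have : 0 ≤ (4 * p : ℤ) * c := by rw [← hc]; positivity
    exact nonneg_of_mul_nonneg_right this (by positivity)
  have hpt : ¬ (p : ℤ) ∣ t := by
    intro h2
    have : (p : ℤ) ∣ d :=
      (dvd_add_right (dvd_pow h2 two_ne_zero)).1 ⟨4 * c, by rw [hc']; ring⟩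
    exact hpd (by exact_mod_cast this)
  -- With denominator `2p` and `t² + d = 4pc`, the norm of `w₀` is `x² + (tx + c)/p`.
  obtain ⟨x, ⟨k, hk⟩, hx⟩ := exists_small_solution hp hp2 hpt (r - c)
  have hC' : (p : ℤ) * (p - 1) ^ 2 + 4 * ((p - 1) * n) + 16 * c + 4 * (p * e) ≤ 4 * r := by
    have h1 : ((d : ℚ) + n ^ 2) / p = 4 * c := by
      have : (n : ℚ) ^ 2 + d = 4 * p * c := by exact_mod_cast hc
      rw [div_eq_iff hpQ]
      linarith
    have h2 : (d : ℚ) + 1 = 4 * e := by exact_mod_cast he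
    rw [h1, h2] at hC
    have : (p : ℚ) * (p - 1) ^ 2 + 4 * ((p - 1) * n) + 16 * c + 4 * (p * e) ≤ 4 * r := by linarith
    exact_mod_cast this
  have hx2 : 4 * x ^ 2 ≤ ((p : ℤ) - 1) ^ 2 := by
    have := pow_le_pow_left₀ (by positivity) hx 2
    rwa [mul_pow, sq_abs] at this
  have htx : 2 * (t * x) ≤ (p - 1) * n := by
    calc 2 * (t * x) ≤ 2 * (|t| * |x|) := by rw [← abs_mul]; linarith [le_abs_self (t * x)]
      _ = (2 * |x|) * n := by rw [ht]; ring
      _ ≤ (p - 1) * n := by gcongr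
  -- Only half of the term `(p-1)n` and a quarter of `(d + n²)/p` are needed here.
  have hm : (e : ℤ) ≤ k - x ^ 2 := by
    have h1 : (p : ℤ) * (4 * x ^ 2) ≤ p * (p - 1) ^ 2 := by gcongr
    have h2 : 0 ≤ ((p : ℤ) - 1) * n := mul_nonneg (by lia) (by positivity)
    refine le_of_mul_le_mul_left ?_ hp0
    linarith
  obtain ⟨m, hm'⟩ := Int.eq_ofNat_of_zero_le (show 0 ≤ k - x ^ 2 - e by lia)
  -- The integer `x₁ + (1 + √-d)/2` has norm `x₁² + x₁ + e`, which accounts for the subtracted `e`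
  -- and for the pronic term.
  obtain ⟨x₁, x₂, x₃, hsum⟩ := exists_sum_two_sq_add_pronic m
  refine isRepresentedBy_stdLattice_four h hp.ne_zero hr hv
    (x + ⟨(t : ℚ) / (2 * p), -1 / (2 * p)⟩) ⟨x₁ + 1 / 2, 1 / 2⟩ ⟨x₂, (0 : ℤ)⟩ ⟨x₃, (0 : ℤ)⟩
    (fun γ hγ => ?_) (isIntegral_half hd4 x₁)
    (isIntegral_mk_intCast _ _) (isIntegral_mk_intCast _ _) ?_
  · rw [mul_add]
    exact (γ.isIntegral_coe.mul (isIntegral_intCast _)).add (hint γ hγ)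
  · have hkQ : (r : ℚ) - c - t * x = p * k := by exact_mod_cast hk
    have hmQ : (k : ℚ) - x ^ 2 - e = x₁ ^ 2 + x₁ + x₂ ^ 2 + x₃ ^ 2 := by
      exact_mod_cast hm'.trans hsum
    have hcQ : (t : ℚ) ^ 2 + d = 4 * p * c := by exact_mod_cast hc'
    have heQ : (d : ℚ) + 1 = 4 * e := by exact_mod_cast he
    simp only [QuadraticAlgebra.re_add, QuadraticAlgebra.im_add, QuadraticAlgebra.re_intCast,
      QuadraticAlgebra.im_intCast]
    push_cast
    field_simp
    linear_combination 4 * p * hkQ + 4 * p ^ 2 * hmQ - hcQ - p ^ 2 * heQ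

end ImQuadField

theorem theorem3 (d : ℕ) [NeZero d] (hd : Squarefree d)
    (p : ℕ) (hp : p.Prime) (hp2 : p ≠ 2) (hpd : ¬ p ∣ d)
    (𝔓 : Ideal (𝓞 (ImQuadField d))) (h𝔓 : 𝔓.IsPrime) (h𝔓np : ¬ 𝔓.IsPrincipal)
    (h𝔓p : 𝔓.under ℤ = Ideal.span {(p : ℤ)})
    {V : Type*} [AddCommGroup V] [Module (ImQuadField d) V] [Module (𝓞 (ImQuadField d)) V]
    [IsScalarTower (𝓞 (ImQuadField d)) (ImQuadField d) V]
    (h : HermitianMap (ImQuadField d) V) :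
    (d % 4 = 1 ∨ d % 4 = 2 →
      ∃ n : ℕ, IsLeast {k : ℕ | 0 < k ∧ -(d : ℤ) ≡ (k : ℤ) ^ 2 [ZMOD p]} n ∧
        ∀ r : ℕ, 0 < r →
          (p : ℚ) * (p - 1) ^ 2 / 4 + (p - 1) * n + (d + n ^ 2) / p + 2 * p * d ≤ r →
          ∀ v : V, h.form v v = (r : ImQuadField d) / (p : ImQuadField d) →
            IsRepresentedBy h (unaryLattice 𝔓 v)
              (stdHermitianMap (ImQuadField d) 4) (stdLattice (ImQuadField d) 4)) ∧
    (d % 4 = 3 →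
      ∃ n : ℕ, IsLeast {k : ℕ | 0 < k ∧ Odd k ∧ -(d : ℤ) ≡ (k : ℤ) ^ 2 [ZMOD p]} n ∧
        ∀ r : ℕ, 0 < r →
          (p : ℚ) * (p - 1) ^ 2 / 4 + (p - 1) * n + (d + n ^ 2) / p + p * (d + 1) / 4 ≤ r →
          ∀ v : V, h.form v v = (r : ImQuadField d) / (p : ImQuadField d) →
            IsRepresentedBy h (unaryLattice 𝔓 v)
              (stdHermitianMap (ImQuadField d) 4) (stdLattice (ImQuadField d) 4)) := by
  constructor
  · intro hd4
    obtain ⟨n, hn⟩ := ImQuadField.exists_isLeast_sq_modEq hd hp hp2 hpd h𝔓np h𝔓p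
    exact ⟨n, hn, fun r hr hC v hv =>
      ImQuadField.isRepresentedBy_of_mod_four_eq_one_or_two hd hd4 hp hp2 hpd h𝔓np h𝔓p h hn.1.2
        hr hC hv⟩
  · intro hd4
    obtain ⟨n, hn⟩ := ImQuadField.exists_isLeast_odd_sq_modEq hd hp hp2 hpd h𝔓np h𝔓p
    exact ⟨n, hn, fun r hr hC v hv =>
      ImQuadField.isRepresentedBy_of_mod_four_eq_three hd hd4 hp hp2 hpd h𝔓np h𝔓p h hn.1.2.1
        hn.1.2.2 hr hC hv⟩
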